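/- Let $k$ be a field, $n\geq 2$, $S=k[x_1,\ldots,x_n]$ and $\mathfrak{n}=(x_1,\ldots,x_n)$. Let $f\in S$ be a nonzero homogeneous polynomial of degree $d\geq 1$, let $R=S/(f)$, and let $\mathfrak{m}$ be the image of $\mathfrak{n}$ in $R$. Write $\mathcal{R}(\mathfrak{n})=S[\mathfrak{n}t]\subseteq S[t]$ and $\mathcal{R}(\mathfrak{m})=R[\mathfrak{m}t]\subseteq R[t]$ for the Rees algebras, and let $\psi$ be the $2\times n$ matrix over $S[T_1,\ldots,T_n]$ with rows $(x_1,\ldots,x_n)$ and $(T_1,\ldots,T_n)$. The $S$-algebra map $S[T_1,\ldots,T_n]\to\mathcal{R}(\mathfrak{n})$, $T_j\mapsto x_jt$, is surjective with kernel the ideal $I_2(\psi)$ of $2\times 2$ minors of $\psi$, so that $\mathcal{R}(\mathfrak{n})\cong S[T_1,\ldots,T_n]/I_2(\psi)$; write $\widetilde{\,\cdot\,}$ for images under this map. Let $\mathcal{J}$ be the kernel of the composition $S[T_1,\ldots,T_n]\to R[T_1,\ldots,T_n]\to\mathcal{R}(\mathfrak{m})$, where the first map is reduction modulo $f$ and the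 second is the $R$-algebra map with $T_j\mapsto \overline{x_j}\,t$, and let $\mathcal{K}=I_2(\psi)+(x_n,T_n)$, so that $\widetilde{\mathcal{K}}=(\widetilde{x_n},\widetilde{T_n})$. For $i\geq 0$ let $\widetilde{\mathcal{K}}^{(i)}$ be the $i$-th symbolic power of $\widetilde{\mathcal{K}}$, that is, the intersection of the contractions to $\mathcal{R}(\mathfrak{n})$ of $\widetilde{\mathcal{K}}^{i}\mathcal{R}(\mathfrak{n})_{\mathfrak{p}}$ over the associated primes $\mathfrak{p}$ of $\mathcal{R}(\mathfrak{n})/\widetilde{\mathcal{K}}$. Then $\widetilde{\mathcal{J}}$ is the kernel of the map $\mathcal{R}(\mathfrak{n})\to\mathcal{R}(\mathfrak{m})$ induced by $S\to R$, and $$\widetilde{\mathcal{J}}=\mathcal{D}:=\frac{\widetilde{f}\,\widetilde{\mathcal{K}}^{(d)}}{\widetilde{x_n}^{\,d}}$$ as fractional ideals of the domain $\mathcal{R}(\mathfrak{n})$. In particular $\mathcal{D}$ is an ideal of $\mathcal{R}(\mathfrak{n})$. Moreover, $\mathcal{D}$ is divisorial, i.e. $\mathcal{R}(\mathfrak{n}):(\mathcal{R}(\mathfrak{n}):\mathcal{D})=\mathcal{D}$,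 the colons being taken in the fraction field of $\mathcal{R}(\mathfrak{n})$. -/

import Mathlib

noncomputable section

namespace HypersurfaceRees

open scoped nonZeroDivisors

/-! ### General notions -/

/-- The ideal `I_t(M)` generated by the `t × t` minors of a matrix `M`. Choices of rows or columns
with repetitions contribute `0`, and reordering a choice only changes the sign of the minor. -/
def minorsIdeal {A : Type*} [CommRing A] {p q : Type*} (t : ℕ) (M : Matrix p q A) : Ideal A :=
  Ideal.span {a | ∃ (r : Fin t → p) (c : Fin t → q), a = (M.submatrix r c).det}

/-- The `i`-th symbolic power `I^{(i)}` of an ideal `I` of a Noetherian ring `A`: the intersection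
over the associated primes `𝔭` of `A ⧸ I` of the contractions `I^i A_𝔭 ∩ A`. -/
def symbolicPower {A : Type*} [CommRing A] (I : Ideal A) (i : ℕ) : Ideal A :=
  ⨅ 𝔭 : {𝔭 : PrimeSpectrum A // 𝔭.asIdeal ∈ associatedPrimes A (A ⧸ I)},
    ((I ^ i).map (algebraMap A (Localization.AtPrime 𝔭.1.asIdeal))).comap
      (algebraMap A (Localization.AtPrime 𝔭.1.asIdeal))

/-- For elements `v₁, …, vₙ` of an ideal `I`, the natural `A`-algebra map
`A[T₁, …, Tₙ] → ℛ(I) = A[It]` with `T_j ↦ v_j t`. -/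
def toRees {A : Type*} [CommRing A] {n : ℕ} (I : Ideal A) (v : Fin n → A) (hv : ∀ j, v j ∈ I) :
    MvPolynomial (Fin n) A →ₐ[A] reesAlgebra I :=
  MvPolynomial.aeval fun j =>
    ⟨Polynomial.monomial 1 (v j), reesAlgebra.monomial_mem.mpr (by simpa using hv j)⟩

/-- The map `ℛ(I) → ℛ(IB)` of Rees algebras induced by a ring map `φ : A → B`: it applies `φ` to
the coefficient in `I^i` of each `t^i`. -/
def reesMap {A B : Type*} [CommRing A] [CommRing B] (φ : A →+* B) (I : Ideal A) :
    reesAlgebra I →+* reesAlgebra (I.map φ) :=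
  ((Polynomial.mapRingHom φ).comp (reesAlgebra I).val.toRingHom).codRestrict
    (reesAlgebra (I.map φ)) (fun a i => by
      have h : φ ((a : Polynomial A).coeff i) ∈ (I ^ i).map φ := Ideal.mem_map_of_mem φ (a.2 i)
      rw [Ideal.map_pow] at h
      simpa using h)

/-- A fractional ideal `D` of a domain `A` is divisorial if `A : (A : D) = D`, the colons being
taken in the fraction field. -/
def IsDivisorial {A : Type*} [CommRing A] [IsDomain A]
    (D : FractionalIdeal A⁰ (FractionRing A)) : Prop :=
  1 / (1 / D) = D

/-! ### The rings `S`, `R` and the ideals `𝔫`, `𝔪` -/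

/-- The polynomial ring `S = k[x₁, …, xₙ]`. -/
abbrev S (k : Type*) [Field k] (n : ℕ) : Type _ := MvPolynomial (Fin n) k

/-- The ring `S[T₁, …, Tₙ]`. -/
abbrev ST (k : Type*) [Field k] (n : ℕ) : Type _ := MvPolynomial (Fin n) (S k n)

/-- The hypersurface ring `R = S/(f)`. -/
abbrev R {k : Type*} [Field k] {n : ℕ} (f : S k n) : Type _ := S k n ⧸ Ideal.span {f}

/-- The quotient map `S → R = S/(f)`. -/
abbrev modf {k : Type*} [Field k] {n : ℕ} (f : S k n) : S k n →+* R f :=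
  Ideal.Quotient.mk (Ideal.span {f})

/-- The ideal `𝔫 = (x₁, …, xₙ)` of `S`. -/
def idealN (k : Type*) [Field k] (n : ℕ) : Ideal (S k n) :=
  Ideal.span (Set.range MvPolynomial.X)

/-- The ideal `𝔪` of `R`, the image of `𝔫`. -/
abbrev idealM {k : Type*} [Field k] {n : ℕ} (f : S k n) : Ideal (R f) :=
  (idealN k n).map (modf f)

theorem X_mem_idealN (k : Type*) [Field k] (n : ℕ) (j : Fin n) :
    (MvPolynomial.X j : S k n) ∈ idealN k n :=
  Ideal.subset_span ⟨j, rfl⟩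

/-! ### The Rees algebras `ℛ(𝔫)`, `ℛ(𝔪)` and the maps between them -/

/-- The Rees algebra `ℛ(𝔫)`. -/
abbrev ReesN (k : Type*) [Field k] (n : ℕ) : Type _ := reesAlgebra (idealN k n)

/-- The Rees algebra `ℛ(𝔪)`. -/
abbrev ReesM {k : Type*} [Field k] {n : ℕ} (f : S k n) : Type _ := reesAlgebra (idealM f)

/-- The map `S[T₁, …, Tₙ] → ℛ(𝔫)`, `T_j ↦ x_j t`. The image of `a` is written `ã`. -/
def tilde (k : Type*) [Field k] (n : ℕ) : ST k n →+* ReesN k n :=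
  (toRees (idealN k n) MvPolynomial.X (X_mem_idealN k n)).toRingHom

/-- The composition `S[T₁, …, Tₙ] → R[T₁, …, Tₙ] → ℛ(𝔪)` of reduction modulo `f` with the map
`T_j ↦ x̄_j t`. -/
def toReesM {k : Type*} [Field k] {n : ℕ} (f : S k n) : ST k n →+* ReesM f :=
  (toRees (idealM f) (fun j => modf f (MvPolynomial.X j))
    (fun j => Ideal.mem_map_of_mem (modf f) (X_mem_idealN k n j))).toRingHom.comp
    (MvPolynomial.map (modf f))

/-- The natural map `ℛ(𝔫) → ℛ(𝔪)` induced by `S → R`. -/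
def reesNToReesM {k : Type*} [Field k] {n : ℕ} (f : S k n) : ReesN k n →+* ReesM f :=
  reesMap (modf f) (idealN k n)

/-! ### The ideals in the statement -/

/-- The `2 × n` matrix `ψ` with rows `x₁, …, xₙ` and `T₁, …, Tₙ`. -/
def psi (k : Type*) [Field k] (n : ℕ) : Matrix (Fin 2) (Fin n) (ST k n) :=
  Matrix.of ![fun j => MvPolynomial.C (MvPolynomial.X j), fun j => MvPolynomial.X j]

/-- The ideal `𝒥` of `S[T₁, …, Tₙ]` defining `ℛ(𝔪)`. -/
def idealJ {k : Type*} [Field k] {n : ℕ} (f : S k n) : Ideal (ST k n) :=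
  RingHom.ker (toReesM f)

/-- The ideal `I₂(ψ) + (x_l, T_l)` of `S[T₁, …, Tₙ]`; for `l = n` this is `𝒦`. -/
def idealK (k : Type*) [Field k] {n : ℕ} (l : Fin n) : Ideal (ST k n) :=
  minorsIdeal 2 (psi k n) ⊔
    Ideal.span {MvPolynomial.C (MvPolynomial.X l), MvPolynomial.X l}

/-- The fractional ideal `f̃ 𝒦̃^{(d)} / x̃_l^d` of `ℛ(𝔫)`, where `𝒦̃` is the image in `ℛ(𝔫)` of the
ideal `I₂(ψ) + (x_l, T_l)`; for `l = n` this is `𝒟`. -/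
def idealD {k : Type*} [Field k] {n : ℕ} (l : Fin n) (d : ℕ) (f : S k n) :
    FractionalIdeal (ReesN k n)⁰ (FractionRing (ReesN k n)) :=
  FractionalIdeal.spanSingleton (ReesN k n)⁰
      (algebraMap (ReesN k n) (FractionRing (ReesN k n)) (tilde k n (MvPolynomial.C f)) /
        algebraMap (ReesN k n) (FractionRing (ReesN k n))
          (tilde k n (MvPolynomial.C (MvPolynomial.X l))) ^ d) *
    (symbolicPower ((idealK k l).map (tilde k n)) d :
      FractionalIdeal (ReesN k n)⁰ (FractionRing (ReesN k n)))

end HypersurfaceRees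

end

namespace HypersurfaceRees

open scoped nonZeroDivisors

/-! Everything is compared inside `S[t]`. For homogeneous `f` of degree `d`, `f * a` lies in `𝔫^i`
iff `a` lies in `𝔫^(i-d)`, a condition on `a` that depends on `f` only through `d`. Hence `f h ∈
ℛ(𝔫)` iff `x_l^d h ∈ ℛ(𝔫)`, for any `h ∈ S[t]` (`C_mul_mem_rees_iff`). The kernel of `ℛ(𝔫) → ℛ(𝔪)`
is `f S[t] ∩ ℛ(𝔫)`, and `𝒦̃^(d) = x_l^d S[t] ∩ ℛ(𝔫)`, so multiplication by `f / x_l^d` carries the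
second onto the first. Divisoriality holds because `x_l` and `x_m` are non-associate primes of
`S[t]`: `g` is in the kernel iff `f` divides both `g x_l^d` and `g x_m^d` in `ℛ(𝔫)`. The
presentation of `ℛ(𝔫)` is a straightening argument on monomials. -/

/-! ### Orders of polynomials and membership in `ℛ(𝔫)` -/

theorem idealN_eq_idealOfVars (k : Type*) [Field k] (n : ℕ) :
    idealN k n = MvPolynomial.idealOfVars (Fin n) k := rfl

theorem homogeneousComponent_mul_of_isHomogeneous {σ A : Type*} [CommSemiring A]
    {f : MvPolynomial σ A} {d : ℕ} (hf : f.IsHomogeneous d) (s : ℕ) (a : MvPolynomial σ A) :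
    MvPolynomial.homogeneousComponent (d + s) (f * a) =
      f * MvPolynomial.homogeneousComponent s a := by
  induction a using MvPolynomial.induction_on' with
  | monomial u c =>
    have h1 := MvPolynomial.isHomogeneous_monomial (R := A) (d := u) c rfl
    rw [MvPolynomial.homogeneousComponent_of_mem h1,
      MvPolynomial.homogeneousComponent_of_mem (hf.mul h1)]
    simp
  | add p q hp hq => simp only [mul_add, map_add, hp, hq]

theorem mem_idealN_pow_iff {k : Type*} [Field k] {n : ℕ} (i : ℕ) (p : S k n) :
    p ∈ idealN k n ^ i ↔ ∀ j < i, MvPolynomial.homogeneousComponent j p = 0 := by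
  rw [idealN_eq_idealOfVars, MvPolynomial.mem_pow_idealOfVars_iff']
  constructor
  · intro h j hj
    ext u
    rw [MvPolynomial.coeff_homogeneousComponent]
    split_ifs with hu
    · rw [h u (hu ▸ hj), MvPolynomial.coeff_zero]
    · simp
  · intro h u hu
    have := congrArg (MvPolynomial.coeff u) (h _ hu)
    simpa [MvPolynomial.coeff_homogeneousComponent] using this

/-- Multiplication by `f` shifts homogeneous components by `d` and kills none, `S` being a domain.
For `i ≤ d` the truncated `i - d` is `0` and both sides hold. -/
theorem mul_mem_idealN_pow_iff {k : Type*} [Field k] {n d : ℕ} {f : S k n} (hf0 : f ≠ 0)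
    (hf : f.IsHomogeneous d) (i : ℕ) (a : S k n) :
    f * a ∈ idealN k n ^ i ↔ a ∈ idealN k n ^ (i - d) := by
  constructor
  · intro h
    rw [mem_idealN_pow_iff] at h ⊢
    intro j hj
    have := h (d + j) (by omega)
    rw [homogeneousComponent_mul_of_isHomogeneous hf] at this
    exact (mul_eq_zero.mp this).resolve_left hf0
  · intro h
    have hfd : f ∈ idealN k n ^ d := by
      rw [mem_idealN_pow_iff]
      intro j hj
      rw [MvPolynomial.homogeneousComponent_of_mem hf, if_neg hj.ne]
    refine Ideal.pow_le_pow_right (by omega : i ≤ d + (i - d)) ?_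
    rw [pow_add]
    exact Ideal.mul_mem_mul hfd h

theorem isHomogeneous_X_pow' {k : Type*} [Field k] {n : ℕ} (l : Fin n) (d : ℕ) :
    (MvPolynomial.X l ^ d : S k n).IsHomogeneous d := by
  simpa using (MvPolynomial.isHomogeneous_X k l).pow d

theorem C_mul_mem_rees_iff {k : Type*} [Field k] {n d : ℕ} {f g : S k n} (hf0 : f ≠ 0)
    (hf : f.IsHomogeneous d) (hg0 : g ≠ 0) (hg : g.IsHomogeneous d) (h : Polynomial (S k n)) :
    Polynomial.C f * h ∈ reesAlgebra (idealN k n) ↔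
      Polynomial.C g * h ∈ reesAlgebra (idealN k n) := by
  simp only [mem_reesAlgebra_iff, Polynomial.coeff_C_mul, mul_mem_idealN_pow_iff hf0 hf,
    mul_mem_idealN_pow_iff hg0 hg]

theorem rees_mem_of_monomial_mem {A : Type*} [CommRing A] {I : Ideal A}
    {K : Ideal (reesAlgebra I)} (g : reesAlgebra I)
    (h : ∀ i, (⟨Polynomial.monomial i ((g : Polynomial A).coeff i),
      reesAlgebra.monomial_mem.mpr (g.2 i)⟩ : reesAlgebra I) ∈ K) : g ∈ K := by
  have : g = ∑ i ∈ (g : Polynomial A).support,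
      (⟨Polynomial.monomial i ((g : Polynomial A).coeff i),
        reesAlgebra.monomial_mem.mpr (g.2 i)⟩ : reesAlgebra I) := by
    apply Subtype.ext
    rw [AddSubmonoidClass.coe_finsetSum]
    exact Polynomial.as_sum_support _
  rw [this]
  exact K.sum_mem fun i _ => h i

/-! ### The presentation of `ℛ(𝔫)` -/

@[simp] theorem coe_tilde_C (k : Type*) [Field k] (n : ℕ) (a : S k n) :
    (tilde k n (MvPolynomial.C a) : Polynomial (S k n)) = Polynomial.C a := by
  simp [tilde, toRees]

@[simp] theorem coe_tilde_X (k : Type*) [Field k] (n : ℕ) (j : Fin n) :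
    (tilde k n (MvPolynomial.X j) : Polynomial (S k n)) =
      Polynomial.monomial 1 (MvPolynomial.X j) := by
  simp [tilde, toRees]

theorem tilde_surjective (k : Type*) [Field k] (n : ℕ) : Function.Surjective (tilde k n) := by
  rintro ⟨g, hg⟩
  let φ : ST k n →ₐ[S k n] Polynomial (S k n) :=
    (reesAlgebra (idealN k n)).val.comp (toRees (idealN k n) MvPolynomial.X (X_mem_idealN k n))
  have hφ : reesAlgebra (idealN k n) ≤ φ.range := by
    rw [← adjoin_monomial_eq_reesAlgebra, idealN, Submodule.map_span, Algebra.adjoin_span]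
    refine Algebra.adjoin_le ?_
    rintro _ ⟨_, ⟨j, rfl⟩, rfl⟩
    exact ⟨MvPolynomial.X j, coe_tilde_X k n j⟩
  obtain ⟨p, hp⟩ := hφ hg
  exact ⟨p, Subtype.ext hp⟩

theorem tilde_minorsIdeal_le (k : Type*) [Field k] (n : ℕ) :
    minorsIdeal 2 (psi k n) ≤ RingHom.ker (tilde k n) := by
  rw [minorsIdeal, Ideal.span_le]
  rintro _ ⟨r, c, rfl⟩
  have key : ∀ a b : Fin 2, ∀ i j : Fin n,
      tilde k n (psi k n a i * psi k n b j - psi k n a j * psi k n b i) = 0 := by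
    have hc : ∀ i j, tilde k n (psi k n 0 i * psi k n 1 j - psi k n 0 j * psi k n 1 i) = 0 := by
      intro i j
      apply Subtype.ext
      simp [psi, Polynomial.C_mul_monomial, mul_comm]
    simp only [Fin.forall_fin_two]
    refine ⟨⟨fun i j => ?_, hc⟩, fun i j => ?_, fun i j => ?_⟩
    · rw [← map_zero (tilde k n)]; congr 1; ring
    · rw [← neg_eq_zero, ← map_neg, ← hc i j]; congr 1; ring
    · rw [← map_zero (tilde k n)]; congr 1; ring
  rw [SetLike.mem_coe, RingHom.mem_ker, Matrix.det_fin_two]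
  simpa using key (r 0) (r 1) (c 0) (c 1)

theorem toMultiset_map_prod {ι Q : Type*} [CommMonoid Q] (x : ι → Q) (β : ι →₀ ℕ) :
    (β.toMultiset.map x).prod = β.prod fun j e => x j ^ e := by
  rw [Finsupp.toMultiset_map, Finsupp.prod_toMultiset,
    Finsupp.prod_mapDomain_index (by simp) (by simp [pow_add])]

theorem coe_tilde_monomial (k : Type*) [Field k] (n : ℕ) (α β : Fin n →₀ ℕ) (c : k) :
    (tilde k n (MvPolynomial.monomial β (MvPolynomial.monomial α c)) : Polynomial (S k n)) =
      Polynomial.monomial β.degree (MvPolynomial.monomial (α + β) c) := by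
  have h : ∀ p, (tilde k n p : Polynomial (S k n)) =
      MvPolynomial.aeval (fun j => (Polynomial.monomial 1 (MvPolynomial.X j) :
        Polynomial (S k n))) p := by
    intro p
    have : (reesAlgebra (idealN k n)).val.comp
        (toRees (idealN k n) MvPolynomial.X (X_mem_idealN k n)) =
        MvPolynomial.aeval (fun j => (Polynomial.monomial 1 (MvPolynomial.X j) :
          Polynomial (S k n))) :=
      MvPolynomial.algHom_ext fun j => by simp [toRees]
    exact DFunLike.congr_fun this p
  rw [h, MvPolynomial.aeval_monomial]
  have h2 : ∀ j : Fin n, (Polynomial.monomial 1 (MvPolynomial.X j) : Polynomial (S k n)) =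
      Polynomial.C (MvPolynomial.X j) * Polynomial.X := by
    intro j; rw [Polynomial.C_mul_X_eq_monomial]
  simp only [h2, mul_pow, Finsupp.prod, Finset.prod_mul_distrib, Finset.prod_pow_eq_pow_sum]
  rw [← mul_one c, ← MvPolynomial.monomial_mul, MvPolynomial.monomial_eq (s := β),
    ← Polynomial.C_mul_X_pow_eq_monomial]
  simp only [Finsupp.prod, map_mul, map_prod, map_pow, map_one, one_mul, mul_one, mul_assoc]
  rfl

/-- Straightening: the exchange relations make a monomial in `x` and `T` depend only on its total
multiset of indices and its degree in `T`. -/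
theorem multiset_prod_mul_prod_eq {ι Q : Type*} [CommRing Q] {x T : ι → Q}
    (h : ∀ i j, x i * T j = x j * T i) (t' : Multiset ι) : ∀ s t s' : Multiset ι,
    s + t = s' + t' → t.card = t'.card →
      (s.map x).prod * (t.map T).prod = (s'.map x).prod * (t'.map T).prod := by
  classical
  induction t' using Multiset.induction_on with
  | empty =>
    intro s t s' hst hc
    obtain rfl : t = 0 := by simpa using hc
    simp_all
  | cons j u' ih =>
    intro s t s' hst hc
    by_cases hj : j ∈ t
    · obtain ⟨u, rfl⟩ := Multiset.exists_cons_of_mem hj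
      have := ih s u s' (by simpa using hst) (by simpa using hc)
      simp only [Multiset.map_cons, Multiset.prod_cons]
      linear_combination T j * this
    -- Here `T j` is missing on the left, so `x j` occurs there; trading `x j * T i` for `x i * T j`
    -- produces it.
    · have hjs : j ∈ s := by
        have : j ∈ s + t := by rw [hst]; simp
        simpa [hj] using this
      obtain ⟨s₀, rfl⟩ := Multiset.exists_cons_of_mem hjs
      obtain ⟨i, hi⟩ : ∃ i, i ∈ t := by
        apply Multiset.card_pos_iff_exists_mem.mp
        rw [hc]; simp
      obtain ⟨u, rfl⟩ := Multiset.exists_cons_of_mem hi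
      have := ih (i ::ₘ s₀) u s' (by
        have h1 : j ::ₘ (i ::ₘ s₀ + u) = j ::ₘ (s' + u') := by
          rw [← Multiset.add_cons j s' u', ← hst]
          simp [Multiset.cons_swap]
        simpa using h1) (by simpa using hc)
      simp only [Multiset.map_cons, Multiset.prod_cons] at this ⊢
      linear_combination T j * this + (s₀.map x).prod * (u.map T).prod * h j i

/-- By straightening, the class of a monomial modulo the minors is determined by its image `x^γ
t^i`. This defines a `k`-linear `σ` on `S[t]` through which the quotient map `π` factors, so `tilde`
kills nothing more than `π`. -/
theorem ker_tilde (k : Type*) [Field k] (n : ℕ) :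
    RingHom.ker (tilde k n) = minorsIdeal 2 (psi k n) := by
  classical
  refine le_antisymm ?_ (tilde_minorsIdeal_le k n)
  let π := Ideal.Quotient.mkₐ k (minorsIdeal 2 (psi k n))
  let x : Fin n → ST k n ⧸ minorsIdeal 2 (psi k n) :=
    fun j => π (MvPolynomial.C (MvPolynomial.X j))
  let T : Fin n → ST k n ⧸ minorsIdeal 2 (psi k n) := fun j => π (MvPolynomial.X j)
  have hxT : ∀ i j, x i * T j = x j * T i := by
    intro i j
    simp only [x, T, ← map_mul]
    refine Ideal.Quotient.eq.mpr (Ideal.subset_span ⟨id, ![i, j], ?_⟩)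
    simp [psi, Matrix.det_fin_two]
  -- Any splitting of `γ` with `i` factors `T` will do; the value `0` covers `i > γ.degree`, where
  -- `x^γ t^i` is outside `ℛ(𝔫)`.
  let N : (Fin n →₀ ℕ) → ℕ → ST k n ⧸ minorsIdeal 2 (psi k n) := fun γ i =>
    if h : ∃ st : Multiset (Fin n) × Multiset (Fin n),
      st.1 + st.2 = Finsupp.toMultiset γ ∧ st.2.card = i
    then (h.choose.1.map x).prod * (h.choose.2.map T).prod else 0
  have hN : ∀ α β : Fin n →₀ ℕ, N (α + β) β.degree =
      π (MvPolynomial.monomial β (MvPolynomial.monomial α 1)) := by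
    intro α β
    have h : ∃ st : Multiset (Fin n) × Multiset (Fin n),
        st.1 + st.2 = Finsupp.toMultiset (α + β) ∧ st.2.card = β.degree :=
      ⟨(Finsupp.toMultiset α, Finsupp.toMultiset β), by simp, Finsupp.card_toMultiset β⟩
    simp only [N, dif_pos h]
    rw [multiset_prod_mul_prod_eq hxT (Finsupp.toMultiset β) _ _ (Finsupp.toMultiset α)
      (by rw [h.choose_spec.1, map_add])
      (by rw [h.choose_spec.2]; exact (Finsupp.card_toMultiset β).symm)]
    rw [MvPolynomial.monomial_eq, MvPolynomial.monomial_eq (s := α)]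
    simp only [toMultiset_map_prod, x, T, map_mul, map_one, one_mul, Finsupp.prod, map_prod,
      map_pow]
  let σ : Polynomial (S k n) →ₗ[k] ST k n ⧸ minorsIdeal 2 (psi k n) :=
    Polynomial.lsum fun i => (MvPolynomial.basisMonomials (Fin n) k).constr k fun γ => N γ i
  have hσ : ∀ p : ST k n, σ (tilde k n p) = π p := by
    intro p
    induction p using MvPolynomial.induction_on' with
    | add p q hp hq => simp only [map_add, Subalgebra.coe_add, hp, hq]
    | monomial β a =>
      induction a using MvPolynomial.induction_on' with
      | add p q hp hq => simp only [map_add, Subalgebra.coe_add, hp, hq]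
      | monomial α c =>
        have h1 : (tilde k n (MvPolynomial.monomial β (MvPolynomial.monomial α c)) :
            Polynomial (S k n)) =
            Polynomial.monomial β.degree (MvPolynomial.monomial (α + β) c) :=
          coe_tilde_monomial k n α β c
        have h2 : MvPolynomial.monomial β (MvPolynomial.monomial α c) =
            c • (MvPolynomial.monomial β (MvPolynomial.monomial α 1) : ST k n) := by
          simp [MvPolynomial.smul_monomial]
        have h3 : MvPolynomial.monomial (α + β) c =
            c • MvPolynomial.basisMonomials (Fin n) k (α + β) := by
          simp [MvPolynomial.smul_monomial]
        rw [h1, h2, h3, ← Polynomial.smul_monomial, map_smul, map_smul, ← hN]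
        simp only [σ, Polynomial.lsum_apply]
        rw [Polynomial.sum_monomial_index _ _ (by simp), Module.Basis.constr_basis]
  intro p hp
  rw [RingHom.mem_ker] at hp
  have := hσ p
  rw [hp] at this
  exact Ideal.Quotient.eq_zero_iff_mem.mp (this.symm.trans (map_zero σ))



/-! ### The symbolic powers of `𝒦̃` -/

theorem prime_C_X (k : Type*) [Field k] {n : ℕ} (l : Fin n) :
    Prime (Polynomial.C (MvPolynomial.X l) : Polynomial (S k n)) :=
  Polynomial.prime_C_iff.mpr MvPolynomial.X_prime

theorem map_idealK_le (k : Type*) [Field k] {n : ℕ} (l : Fin n) :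
    (idealK k l).map (tilde k n) ≤
      (Ideal.span {(Polynomial.C (MvPolynomial.X l) : Polynomial (S k n))}).comap
        (reesAlgebra (idealN k n)).val.toRingHom := by
  rw [Ideal.map_le_iff_le_comap, idealK, sup_le_iff]
  constructor
  · refine (tilde_minorsIdeal_le k n).trans fun p hp => ?_
    rw [RingHom.mem_ker] at hp
    rw [Ideal.mem_comap, hp]
    exact Ideal.zero_mem _
  · rw [Ideal.span_le]
    rintro _ (rfl | rfl)
    · simp
    · rw [SetLike.mem_coe, Ideal.mem_comap, Ideal.mem_comap, Ideal.mem_span_singleton]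
      exact ⟨Polynomial.X, by simp [Polynomial.C_mul_X_eq_monomial]⟩

/-- Both generators `x_l` and `x_l t` are multiples of `x_l`. Conversely, in degree `j` the cofactor
of `x_l^i` lies in `𝔫^(j-i)`, and the remaining powers of `t` are absorbed by turning factors `x_l`
into `x_l t`. -/
theorem mem_map_idealK_pow_iff {k : Type*} [Field k] {n : ℕ} (l : Fin n) (i : ℕ)
    (g : ReesN k n) :
    g ∈ (idealK k l).map (tilde k n) ^ i ↔
      Polynomial.C (MvPolynomial.X l) ^ i ∣ (g : Polynomial (S k n)) := by
  constructor
  · intro hg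
    have := Ideal.le_comap_pow _ i (Ideal.pow_right_mono (map_idealK_le k l) i hg)
    rw [Ideal.span_singleton_pow, Ideal.mem_comap, Ideal.mem_span_singleton] at this
    exact this
  · rintro ⟨h, hh⟩
    have hx0 : (MvPolynomial.X l ^ i : S k n) ≠ 0 := pow_ne_zero _ (MvPolynomial.X_ne_zero l)
    have hxC : tilde k n (MvPolynomial.C (MvPolynomial.X l)) ∈ (idealK k l).map (tilde k n) :=
      Ideal.mem_map_of_mem _ (Ideal.mem_sup_right (Ideal.subset_span (by simp)))
    have hxT : tilde k n (MvPolynomial.X l) ∈ (idealK k l).map (tilde k n) :=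
      Ideal.mem_map_of_mem _ (Ideal.mem_sup_right (Ideal.subset_span (by simp)))
    refine rees_mem_of_monomial_mem g fun j => ?_
    have hcoeff : (g : Polynomial (S k n)).coeff j = MvPolynomial.X l ^ i * h.coeff j := by
      rw [hh, ← Polynomial.C_pow, Polynomial.coeff_C_mul]
    have hmem : h.coeff j ∈ idealN k n ^ (j - i) := by
      rw [← mul_mem_idealN_pow_iff hx0 (isHomogeneous_X_pow' l i), ← hcoeff]
      exact g.2 j
    let a : ReesN k n := ⟨Polynomial.monomial (j - i) (h.coeff j),
      reesAlgebra.monomial_mem.mpr hmem⟩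
    -- `s` counts the factors `x_l t`; when `j < i` only `j` of them are needed.
    obtain ⟨s, hs, hsj⟩ : ∃ s ≤ i, s + (j - i) = j := ⟨min i j, min_le_left _ _, by omega⟩
    have heq : (⟨Polynomial.monomial j ((g : Polynomial (S k n)).coeff j),
        reesAlgebra.monomial_mem.mpr (g.2 j)⟩ : ReesN k n) =
        tilde k n (MvPolynomial.C (MvPolynomial.X l)) ^ (i - s) *
          tilde k n (MvPolynomial.X l) ^ s * a := by
      apply Subtype.ext
      simp only [Subalgebra.coe_mul, Subalgebra.coe_pow, coe_tilde_C, coe_tilde_X, a,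
        Polynomial.monomial_pow, hcoeff]
      rw [← Polynomial.C_pow, Polynomial.C_mul_monomial, Polynomial.monomial_mul_monomial,
        ← pow_add, one_mul, hsj, Nat.sub_add_cancel hs]
    rw [heq]
    refine Ideal.mul_mem_right _ _ ?_
    have := Ideal.mul_mem_mul (Ideal.pow_mem_pow hxC (i - s)) (Ideal.pow_mem_pow hxT s)
    rwa [← pow_add, Nat.sub_add_cancel hs] at this

theorem mem_map_idealK_iff {k : Type*} [Field k] {n : ℕ} (l : Fin n) (g : ReesN k n) :
    g ∈ (idealK k l).map (tilde k n) ↔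
      Polynomial.C (MvPolynomial.X l) ∣ (g : Polynomial (S k n)) := by
  simpa using mem_map_idealK_pow_iff l 1 g

theorem isPrime_map_idealK (k : Type*) [Field k] {n : ℕ} (l : Fin n) :
    ((idealK k l).map (tilde k n)).IsPrime := by
  have h : (idealK k l).map (tilde k n) =
      (Ideal.span {(Polynomial.C (MvPolynomial.X l) : Polynomial (S k n))}).comap
        (reesAlgebra (idealN k n)).val.toRingHom := by
    refine le_antisymm (map_idealK_le k l) fun g hg => ?_
    rw [Ideal.mem_comap, Ideal.mem_span_singleton] at hg
    exact (mem_map_idealK_iff l g).mpr hg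
  rw [h]
  have := (Ideal.span_singleton_prime (prime_C_X k l).ne_zero).mpr (prime_C_X k l)
  exact Ideal.comap_isPrime _ _

/-- `𝒦̃` is prime, hence the only associated prime. A denominator outside it is not divisible by the
prime `x_l` of `S[t]`, so it cancels: symbolic and ordinary powers agree. -/
theorem mem_symbolicPower_map_idealK_iff {k : Type*} [Field k] {n : ℕ} (l : Fin n) (i : ℕ)
    (g : ReesN k n) :
    g ∈ symbolicPower ((idealK k l).map (tilde k n)) i ↔
      Polynomial.C (MvPolynomial.X l) ^ i ∣ (g : Polynomial (S k n)) := by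
  have hp := isPrime_map_idealK k l
  have : IsNoetherianRing (ReesN k n) := inferInstance
  have hass : associatedPrimes (ReesN k n) (ReesN k n ⧸ (idealK k l).map (tilde k n)) =
      {(idealK k l).map (tilde k n)} := by
    rw [associatedPrimes.eq_singleton_of_isPrimary hp.isPrimary, hp.radical]
  rw [symbolicPower, Ideal.mem_iInf]
  constructor
  · intro h
    have h1 := h ⟨⟨_, hp⟩, by rw [hass]; rfl⟩
    rw [Ideal.mem_comap,
      IsLocalization.algebraMap_mem_map_algebraMap_iff
        ((idealK k l).map (tilde k n)).primeCompl] at h1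
    obtain ⟨s, hs, hsg⟩ := h1
    rw [mem_map_idealK_pow_iff, Subalgebra.coe_mul] at hsg
    refine (prime_C_X k l).pow_dvd_of_dvd_mul_left i (fun hd => hs ?_) hsg
    exact (mem_map_idealK_iff l s).mpr hd
  · rintro h ⟨q, hq⟩
    exact Ideal.mem_comap.mpr (Ideal.mem_map_of_mem _ ((mem_map_idealK_pow_iff l i g).mpr h))

/-! ### The kernel of `ℛ(𝔫) → ℛ(𝔪)` -/

theorem reesNToReesM_comp_tilde {k : Type*} [Field k] {n : ℕ} (f : S k n) :
    (reesNToReesM f).comp (tilde k n) = toReesM f := by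
  refine MvPolynomial.ringHom_ext (fun a => ?_) fun j => ?_
  · apply Subtype.ext
    change Polynomial.map (modf f) (tilde k n (MvPolynomial.C a) : Polynomial (S k n)) = _
    simp [toReesM, toRees]
  · apply Subtype.ext
    change Polynomial.map (modf f) (tilde k n (MvPolynomial.X j) : Polynomial (S k n)) = _
    simp [toReesM, toRees]

theorem map_idealJ {k : Type*} [Field k] {n : ℕ} (f : S k n) :
    (idealJ f).map (tilde k n) = RingHom.ker (reesNToReesM f) := by
  rw [idealJ, ← reesNToReesM_comp_tilde, ← RingHom.comap_ker,
    Ideal.map_comap_of_surjective _ (tilde_surjective k n)]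

theorem mem_ker_reesNToReesM_iff {k : Type*} [Field k] {n : ℕ} (f : S k n) (g : ReesN k n) :
    g ∈ RingHom.ker (reesNToReesM f) ↔ Polynomial.C f ∣ (g : Polynomial (S k n)) := by
  rw [RingHom.mem_ker, Polynomial.C_dvd_iff_dvd_coeff, ← Subtype.coe_inj]
  change Polynomial.map (modf f) (g : Polynomial (S k n)) = 0 ↔ _
  rw [Polynomial.ext_iff]
  simp [Ideal.Quotient.eq_zero_iff_dvd]

theorem coe_ker_eq_idealD {k : Type*} [Field k] {n d : ℕ} {f : S k n} (hf0 : f ≠ 0)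
    (hf : f.IsHomogeneous d) (l : Fin n) :
    (RingHom.ker (reesNToReesM f) : FractionalIdeal (ReesN k n)⁰ (FractionRing (ReesN k n))) =
      idealD l d f := by
  have hx0 : (MvPolynomial.X l ^ d : S k n) ≠ 0 := pow_ne_zero _ (MvPolynomial.X_ne_zero l)
  have hxt : algebraMap (ReesN k n) (FractionRing (ReesN k n))
      (tilde k n (MvPolynomial.C (MvPolynomial.X l))) ^ d ≠ 0 := by
    refine pow_ne_zero _ ?_
    rw [map_ne_zero_iff _ (IsFractionRing.injective (ReesN k n) (FractionRing (ReesN k n))), Ne,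
      ← Subtype.coe_inj, coe_tilde_C]
    exact (prime_C_X k l).ne_zero
  -- The common cofactor `h` lives in `S[t]` and need not belong to `ℛ(𝔫)`.
  have key : ∀ (h : Polynomial (S k n)) (g z : ReesN k n), (g : Polynomial (S k n)) =
      Polynomial.C f * h → (z : Polynomial (S k n)) = Polynomial.C (MvPolynomial.X l) ^ d * h →
      algebraMap (ReesN k n) (FractionRing (ReesN k n)) g =
        algebraMap (ReesN k n) (FractionRing (ReesN k n)) (tilde k n (MvPolynomial.C f)) /
        algebraMap (ReesN k n) (FractionRing (ReesN k n))
          (tilde k n (MvPolynomial.C (MvPolynomial.X l))) ^ d *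
        algebraMap (ReesN k n) (FractionRing (ReesN k n)) z := by
    intro h g z hg hz
    rw [div_mul_eq_mul_div, eq_div_iff hxt, ← map_pow, ← map_mul, ← map_mul]
    congr 1
    apply Subtype.ext
    simp only [Subalgebra.coe_mul, Subalgebra.coe_pow, coe_tilde_C, hg, hz]
    ring
  ext y
  rw [idealD, FractionalIdeal.mem_singleton_mul, FractionalIdeal.mem_coeIdeal]
  constructor
  · rintro ⟨g, hg, rfl⟩
    obtain ⟨h, hh⟩ := (mem_ker_reesNToReesM_iff f g).mp hg
    have hz : Polynomial.C (MvPolynomial.X l ^ d) * h ∈ reesAlgebra (idealN k n) := by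
      rw [C_mul_mem_rees_iff hx0 (isHomogeneous_X_pow' l d) hf0 hf, ← hh]
      exact g.2
    refine ⟨_, FractionalIdeal.mem_coeIdeal_of_mem _ (I := symbolicPower _ _)
      ((mem_symbolicPower_map_idealK_iff l d ⟨_, hz⟩).mpr ?_), key h g ⟨_, hz⟩ hh (by simp)⟩
    exact ⟨h, by simp⟩
  · rintro ⟨_, hz, rfl⟩
    obtain ⟨z, hzK, rfl⟩ := (FractionalIdeal.mem_coeIdeal _).mp hz
    obtain ⟨h, hh⟩ := (mem_symbolicPower_map_idealK_iff l d z).mp hzK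
    have hg : Polynomial.C f * h ∈ reesAlgebra (idealN k n) := by
      rw [C_mul_mem_rees_iff hf0 hf hx0 (isHomogeneous_X_pow' l d), Polynomial.C_pow, ← hh]
      exact z.2
    exact ⟨⟨_, hg⟩, (mem_ker_reesNToReesM_iff f _).mpr ⟨h, rfl⟩, key h ⟨_, hg⟩ z rfl hh⟩

/-! ### Divisoriality -/

/-- An ideal `J` is divisorial if it is the set of `g` such that `g * u` and `g * v` are multiples
of `a`, where `a` is a nonzero element of `J`. -/
theorem isDivisorial_of_forall_mem_iff {A : Type*} [CommRing A] [IsDomain A] {J : Ideal A}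
    {a u v : A} (ha : a ≠ 0) (haJ : a ∈ J) (h : ∀ g, g ∈ J ↔ a ∣ g * u ∧ a ∣ g * v) :
    IsDivisorial (J : FractionalIdeal A⁰ (FractionRing A)) := by
  have hinj := IsFractionRing.injective A (FractionRing A)
  have ha' : algebraMap A (FractionRing A) a ≠ 0 := (map_ne_zero_iff _ hinj).mpr ha
  have hJ0 : (J : FractionalIdeal A⁰ (FractionRing A)) ≠ 0 := by
    rw [Ne, FractionalIdeal.coeIdeal_eq_zero]
    rintro rfl
    exact ha haJ
  -- This forces the double dual of `J` into `A`.
  have hone : (1 : FractionRing A) ∈ (1 / J : FractionalIdeal A⁰ (FractionRing A)) := by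
    rw [FractionalIdeal.mem_div_iff_of_ne_zero hJ0]
    intro y hy
    rw [one_mul]
    exact FractionalIdeal.coeIdeal_le_one hy
  have hd0 : (1 / J : FractionalIdeal A⁰ (FractionRing A)) ≠ 0 := by
    intro h0
    rw [h0, FractionalIdeal.mem_zero_iff] at hone
    exact one_ne_zero hone
  -- With `w = u` and `w = v`, the fractions `u / a` and `v / a` in `A : J` test membership in the
  -- double dual.
  have hdiv : ∀ w, (∀ g ∈ J, a ∣ g * w) →
      algebraMap A (FractionRing A) w / algebraMap A (FractionRing A) a ∈
        (1 / J : FractionalIdeal A⁰ (FractionRing A)) := by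
    intro w hw
    rw [FractionalIdeal.mem_div_iff_of_ne_zero hJ0]
    intro y hy
    obtain ⟨g, hg, rfl⟩ := (FractionalIdeal.mem_coeIdeal _).mp hy
    obtain ⟨c, hc⟩ := hw g hg
    rw [FractionalIdeal.mem_one_iff]
    refine ⟨c, ?_⟩
    rw [div_mul_eq_mul_div, eq_div_iff ha', ← map_mul, ← map_mul, mul_comm w, hc, mul_comm]
  refine le_antisymm ?_ ?_
  · intro q hq
    replace hq := (FractionalIdeal.mem_div_iff_of_ne_zero hd0).mp hq
    obtain ⟨g, rfl⟩ := (FractionalIdeal.mem_one_iff _).mp (mul_one q ▸ hq 1 hone)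
    have hmul : ∀ w, (∀ g ∈ J, a ∣ g * w) → a ∣ g * w := by
      intro w hw
      obtain ⟨b, hb⟩ := (FractionalIdeal.mem_one_iff _).mp (hq _ (hdiv w hw))
      rw [← mul_div_assoc, eq_div_iff ha', ← map_mul, ← map_mul] at hb
      exact ⟨b, by rw [← hinj hb, mul_comm]⟩
    exact FractionalIdeal.mem_coeIdeal_of_mem _
      ((h g).mpr ⟨hmul u fun g hg => ((h g).mp hg).1, hmul v fun g hg => ((h g).mp hg).2⟩)
  · rw [FractionalIdeal.le_div_iff_of_ne_zero hd0]
    intro x hx y hy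
    rw [mul_comm]
    exact (FractionalIdeal.mem_div_iff_of_ne_zero hJ0).mp hy x hx

theorem isDivisorial_ker {k : Type*} [Field k] {n d : ℕ} {f : S k n} (hf0 : f ≠ 0)
    (hf : f.IsHomogeneous d) {l m : Fin n} (hlm : l ≠ m) :
    IsDivisorial
      (RingHom.ker (reesNToReesM f) :
        FractionalIdeal (ReesN k n)⁰ (FractionRing (ReesN k n))) := by
  refine isDivisorial_of_forall_mem_iff (a := tilde k n (MvPolynomial.C f))
    (u := tilde k n (MvPolynomial.C (MvPolynomial.X l ^ d)))
    (v := tilde k n (MvPolynomial.C (MvPolynomial.X m ^ d))) ?_ ?_ fun g => ?_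
  · rw [Ne, ← Subtype.coe_inj, coe_tilde_C]
    exact Polynomial.C_ne_zero.mpr hf0
  · rw [mem_ker_reesNToReesM_iff, coe_tilde_C]
  rw [mem_ker_reesNToReesM_iff]
  constructor
  · rintro ⟨h, hh⟩
    have hdvd : ∀ j : Fin n, tilde k n (MvPolynomial.C f) ∣
        g * tilde k n (MvPolynomial.C (MvPolynomial.X j ^ d)) := by
      intro j
      have hz : Polynomial.C (MvPolynomial.X j ^ d) * h ∈ reesAlgebra (idealN k n) := by
        rw [C_mul_mem_rees_iff (pow_ne_zero _ (MvPolynomial.X_ne_zero j))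
          (isHomogeneous_X_pow' j d) hf0 hf, ← hh]
        exact g.2
      refine ⟨⟨_, hz⟩, Subtype.ext ?_⟩
      simp only [Subalgebra.coe_mul, coe_tilde_C, hh]
      ring
    exact ⟨hdvd l, hdvd m⟩
  · rintro ⟨⟨b, hb⟩, c, hc⟩
    replace hb := congrArg Subtype.val hb
    replace hc := congrArg Subtype.val hc
    simp only [Subalgebra.coe_mul, coe_tilde_C, Polynomial.C_pow] at hb hc
    generalize (b : Polynomial (S k n)) = b at hb
    generalize (c : Polynomial (S k n)) = c at hc
    -- Comparing `g x_l^d = f b` with `g x_m^d = f c` in `S[t]`, coprimality gives `x_l^d ∣ b`,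
    -- hence `f ∣ g`.
    have hbc : b * Polynomial.C (MvPolynomial.X m) ^ d =
        c * Polynomial.C (MvPolynomial.X l) ^ d := by
      apply mul_left_cancel₀ (Polynomial.C_ne_zero.mpr hf0)
      linear_combination Polynomial.C (MvPolynomial.X l) ^ d * hc -
        Polynomial.C (MvPolynomial.X m) ^ d * hb
    have hnd : ¬ (Polynomial.C (MvPolynomial.X l) : Polynomial (S k n)) ∣
        Polynomial.C (MvPolynomial.X m) ^ d := by
      intro h
      have h1 := (prime_C_X k l).dvd_of_dvd_pow h
      rw [Polynomial.C_dvd_iff_dvd_coeff] at h1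
      have h2 := h1 0
      rw [Polynomial.coeff_C_zero, MvPolynomial.X_dvd_X] at h2
      simp [hlm] at h2
    have hdvd : Polynomial.C (MvPolynomial.X l) ^ d ∣ b * Polynomial.C (MvPolynomial.X m) ^ d :=
      ⟨c, by rw [hbc, mul_comm]⟩
    obtain ⟨e, he⟩ := (prime_C_X k l).pow_dvd_of_dvd_mul_right d hnd hdvd
    refine ⟨e, mul_right_cancel₀ (pow_ne_zero d (prime_C_X k l).ne_zero) ?_⟩
    rw [hb, he]
    ring

end HypersurfaceRees

open scoped nonZeroDivisors in
theorem theorem3p5 {k : Type*} [Field k] (n : ℕ) (hn : 2 ≤ n) (d : ℕ) (hd : 1 ≤ d)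
    (f : HypersurfaceRees.S k n) (hf0 : f ≠ 0) (hf : f.IsHomogeneous d) :
    -- the identification `ℛ(𝔫) = S[T₁, …, Tₙ] / I₂(ψ)`
    (Function.Surjective (HypersurfaceRees.tilde k n) ∧
      RingHom.ker (HypersurfaceRees.tilde k n) =
        HypersurfaceRees.minorsIdeal 2 (HypersurfaceRees.psi k n)) ∧
    -- the image of `𝒥` is the kernel of `ℛ(𝔫) → ℛ(𝔪)`
    (HypersurfaceRees.idealJ f).map (HypersurfaceRees.tilde k n) =
      RingHom.ker (HypersurfaceRees.reesNToReesM f) ∧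
    -- this kernel is `𝒟 = f̃ 𝒦̃^{(d)} / x̃ₙ^d`, which is divisorial
    (RingHom.ker (HypersurfaceRees.reesNToReesM f) :
        FractionalIdeal (HypersurfaceRees.ReesN k n)⁰
          (FractionRing (HypersurfaceRees.ReesN k n))) =
      HypersurfaceRees.idealD (⟨n - 1, by omega⟩ : Fin n) d f ∧
    HypersurfaceRees.IsDivisorial
      (HypersurfaceRees.idealD (⟨n - 1, by omega⟩ : Fin n) d f) := by
  have h0 : 0 < n := by omega
  have hD := HypersurfaceRees.coe_ker_eq_idealD hf0 hf (⟨n - 1, by omega⟩ : Fin n)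
  refine ⟨⟨HypersurfaceRees.tilde_surjective k n, HypersurfaceRees.ker_tilde k n⟩,
    HypersurfaceRees.map_idealJ f, hD, ?_⟩
  rw [← hD]
  -- Two distinct variables exist because `n ≥ 2`.
  refine HypersurfaceRees.isDivisorial_ker hf0 hf (l := ⟨n - 1, by omega⟩)
    (m := ⟨0, h0⟩) ?_
  rw [Ne, Fin.mk.injEq]
  omega
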